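/- Let $\lambda>0$. Call a real sequence $(c_k)_{k\in\mathbb Z}$ with $\sum_k c_k^2<\infty$ cardinal if the function $\chi(x)=\sum_{k\in\mathbb Z}c_k e^{-\lambda(x-k)^2}$ satisfies $\chi(j)=\delta_{0j}$ for all $j\in\mathbb Z$. There is exactly one cardinal sequence $(c_k)_{k\in\mathbb Z}$. It alternates in sign, that is, $$(-1)^k c_k\ge 0\qquad\text{for every } k\in\mathbb Z,$$ and $\sum_k|c_k|<\infty$. Consequently, for every $1\le p\le\infty$ (and real or complex scalars), the bi-infinite Toeplitz matrix $A=(e^{-\lambda(j-k)^2})_{j,k\in\mathbb Z}$ defines a bounded, boundedly invertible operator on $\ell^p(\mathbb Z)$, its inverse is given by the matrix $(c_{j-k})_{j,k\in\mathbb Z}$, and $$\|A^{-1}\|_{\ell^p\to\ell^p}=\sum_{k\in\mathbb Z}|c_k|=\sum_{k\in\mathbb Z}(-1)^kc_k,$$ so that the norm is the same for all $p$. Moreover, for every dimension $d$, there is exactly one real square-summable family $(c^{(d)}_k)_{k\in\mathbb Z^d}$ such that $\chi(x)=\sum_{k\in\mathbb Z^d}c^{(d)}_k e^{-\lambda\|x-k\|^2}$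 (Euclidean norm on $\mathbb R^d$) satisfies $\chi(j)=\delta_{0j}$ for all $j\in\mathbb Z^d$. It is given by $$c^{(d)}_k=(2\pi)^{-d}\int_{[-\pi,\pi]^d}\frac{e^{-ik\cdot\xi}}{\sigma^{(d)}(\xi)}\,d\xi,\qquad \sigma^{(d)}(\xi)=\sum_{m\in\mathbb Z^d}\hat\varphi(\xi+2\pi m),\qquad \hat\varphi(\xi)=\int_{\mathbb R^d}e^{-\lambda\|x\|^2}e^{-ix\cdot\xi}\,dx,$$ and it satisfies $$(-1)^{k_1+\cdots+k_d}\,c^{(d)}_k\ge 0\qquad\text{for every } k=(k_1,\dots,k_d)\in\mathbb Z^d.$$ -/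

import Mathlib

open scoped ENNReal

noncomputable section

namespace GaussianCardinal

/-- The univariate Gaussian `x ↦ exp (-lam * x ^ 2)`. -/
def gaussian (lam : ℝ) (x : ℝ) : ℝ :=
  Real.exp (-lam * x ^ 2)

/-- The function `χ x = ∑ k, c k * φ (x - k)` on the real line. -/
def chi (lam : ℝ) (c : ℤ → ℝ) (x : ℝ) : ℝ :=
  ∑' k : ℤ, c k * gaussian lam (x - k)

/-- `c` is a square-summable coefficient sequence whose function `χ` is the cardinal function of
interpolation on `ℤ`, that is `χ j = δ_{0 j}` for every integer `j`. -/
structure IsCardinalCoeff (lam : ℝ) (c : ℤ → ℝ) : Prop where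
  sq_summable : Summable fun k => c k ^ 2
  interpolates : ∀ j : ℤ, chi lam c j = if j = 0 then 1 else 0

/-- The Gaussian `x ↦ exp (-lam * ‖x‖ ^ 2)` on `ℝ ^ d`, with the Euclidean norm written out. -/
def gaussianD (lam : ℝ) (d : ℕ) (x : Fin d → ℝ) : ℝ :=
  Real.exp (-lam * ∑ i, x i ^ 2)

/-- The function `χ x = ∑ k, c k * φ (x - k)`, with `k` in `ℤ ^ d`, on `ℝ ^ d`. -/
def chiD (lam : ℝ) (d : ℕ) (c : (Fin d → ℤ) → ℝ) (x : Fin d → ℝ) : ℝ :=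
  ∑' k : Fin d → ℤ, c k * gaussianD lam d (fun i => x i - k i)

/-- `c` is a square-summable coefficient family whose function `χ` is the cardinal function of
interpolation on `ℤ ^ d`. -/
structure IsCardinalCoeffD (lam : ℝ) (d : ℕ) (c : (Fin d → ℤ) → ℝ) : Prop where
  sq_summable : Summable fun k => c k ^ 2
  interpolates : ∀ j : Fin d → ℤ, chiD lam d c (fun i => (j i : ℝ)) = if j = 0 then 1 else 0

/-- The Fourier transform `φ̂ ξ = ∫ φ x * exp (-i x · ξ) dx` of the Gaussian on `ℝ ^ d`. -/
def gaussianHatD (lam : ℝ) (d : ℕ) (ξ : Fin d → ℝ) : ℂ :=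
  ∫ x : Fin d → ℝ, (gaussianD lam d x : ℂ) * Complex.exp (-Complex.I * ((∑ i, x i * ξ i : ℝ) : ℂ))

/-- The symbol `σ ξ = ∑ k, φ̂ (ξ + 2 π k)`, with `k` in `ℤ ^ d`. -/
def symbolD (lam : ℝ) (d : ℕ) (ξ : Fin d → ℝ) : ℂ :=
  ∑' k : Fin d → ℤ, gaussianHatD lam d (fun i => ξ i + 2 * Real.pi * k i)

/-- `(2 π) ^ (-d) * ∫ (1 / σ ξ) * exp (-i k · ξ) dξ` over the cube `[-π, π] ^ d`. -/
def fourierCoeffD (lam : ℝ) (d : ℕ) (k : Fin d → ℤ) : ℂ :=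
  (1 / (2 * Real.pi : ℂ) ^ d) *
    ∫ ξ in Set.Icc (fun _ : Fin d => -Real.pi) (fun _ : Fin d => Real.pi),
      (1 / symbolD lam d ξ) * Complex.exp (-Complex.I * ((∑ i, (k i : ℝ) * ξ i : ℝ) : ℂ))

/-- The operator `T` on `ℓ^p(ℤ)` is given by the bi-infinite Toeplitz matrix `(a (j - k))_{j, k}`:
every row series converges and `(T x) j = ∑ k, a (j - k) * x k`. -/
def IsToeplitz {𝕜 : Type} [RCLike 𝕜] {p : ℝ≥0∞} [Fact (1 ≤ p)]
    (a : ℤ → ℝ) (T : lp (fun _ : ℤ => 𝕜) p →L[𝕜] lp (fun _ : ℤ => 𝕜) p) : Prop :=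
  ∀ (x : lp (fun _ : ℤ => 𝕜) p) (j : ℤ), HasSum (fun k : ℤ => (a (j - k) : 𝕜) * x k) (T x j)

end GaussianCardinal

end

/-!
The inverse of the Gaussian Toeplitz matrix has a closed form. With the alternating tails
`S m = ∑_{n ≥ 0} (-1)^n exp (-lam (m + n + 1/2)^2)`, the cardinal coefficients are
`c k = (-1)^k exp (lam k^2) S |k| / C`, where `C = ∑ k, (-1)^k S |k|`.
The alternating series bounds `0 < S m ≤ exp (-lam (m + 1/2)^2)` give the sign pattern and
`|c k| ≤ exp (-lam |k|) / C` (`abs_rawCoeff_le`), hence absolute summability.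

That `c` interpolates (`gaussian_conv_rawCoeff`) comes from expanding the square:
`∑ k, exp (-lam (j - k)^2) c k` is a multiple of `∑ k, exp (2 lam j k) (-1)^k S |k|`. The sequence
`s k = (-1)^k S |k|` satisfies `s k - s (k + 1) = (-1)^k exp (-lam (k + 1/2)^2)` at every integer `k`,
so for `j ≠ 0` summation by parts leaves an alternating sum of Gaussian values placed symmetrically
about a half-integer, which vanishes. That `C > 0` is the value at `ξ = π` of the product
of the Fourier series of the two sequences: it is positive for the Gaussian by Poisson summation and
for the coefficients by their signs (`rawConst_pos`).

Everything else rests on `a * (c * x) = x` for bounded `x` (`tsum_conv_conv`). It gives uniqueness,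
since square-summable sequences are bounded; it inverts the operators on `ℓ^p`; and it shows that the
Fourier series of `c` is the reciprocal of the symbol. The norm of the inverse is at most `∑ |c k|`,
as a superposition of translations, and at least that, by testing on `(-1)^k r^|k|` with `r → 1`
(`tsum_abs_le_norm_of_isToeplitz`). In dimension `d` the Gaussian, the symbol, the coefficients and
the Fourier integral are all products of univariate ones.
-/

namespace GaussianCardinal

/-! ### Convolution on an abelian group -/

theorem summable_conv_mul {G 𝕜 : Type*} [AddCommGroup G] [RCLike 𝕜] {a : G → ℝ} {x : G → 𝕜}
    (ha : Summable fun k => |a k|) {M : ℝ} (hx : ∀ k, ‖x k‖ ≤ M) (j : G) :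
    Summable fun k => (a (j - k) : 𝕜) * x k := by
  refine Summable.of_norm_bounded (g := fun k => |a (j - k)| * M) ?_ fun k => ?_
  · exact (((Equiv.subLeft j).summable_iff (f := fun k => |a k|)).2 ha).mul_right M
  · rw [norm_mul, RCLike.norm_ofReal]
    gcongr
    exact hx k

/-- If `a * c = C δ` with `a`, `c` absolutely summable, then `a * (c * x) = C x` for every bounded
`x`. This one instance of associativity gives uniqueness of the interpolant (`C = 1`, real `x`),
the inversion of Toeplitz operators on `ℓ^p`, and, for `x` a character, the product of the two
Fourier series. -/
theorem tsum_conv_conv {G 𝕜 : Type*} [AddCommGroup G] [RCLike 𝕜] [DecidableEq G] {a c : G → ℝ}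
    (ha : Summable fun k => |a k|) (hc : Summable fun k => |c k|) {C : ℝ}
    (h : ∀ j, ∑' k, a (j - k) * c k = if j = 0 then C else 0)
    {x : G → 𝕜} {M : ℝ} (hx : ∀ k, ‖x k‖ ≤ M) (j : G) :
    ∑' k, (a (j - k) : 𝕜) * ∑' m, (c (k - m) : 𝕜) * x m = C * x j := by
  have hsum : Summable fun q : G × G => (a (j - q.1) : 𝕜) * ((c (q.1 - q.2) : 𝕜) * x q.2) := by
    have h1 : Summable fun q : G × G => |a q.1| * |c q.2| := by
      have := Summable.mul_norm (f := fun k => |a k|) (g := fun k => |c k|)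
        (by simpa using ha) (by simpa using hc)
      simpa using this
    have he : Function.Injective fun q : G × G => (j - q.1, q.1 - q.2) := by
      rintro ⟨k, m⟩ ⟨k', m'⟩ hq
      simp only [Prod.mk.injEq, sub_right_inj] at hq ⊢
      obtain ⟨rfl, hm⟩ := hq
      exact ⟨rfl, sub_right_inj.1 hm⟩
    refine Summable.of_norm_bounded (g := fun q => |a (j - q.1)| * |c (q.1 - q.2)| * M)
      ((h1.comp_injective he).mul_right M) fun q => ?_
    rw [norm_mul, norm_mul, RCLike.norm_ofReal, RCLike.norm_ofReal, ← mul_assoc]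
    gcongr
    exact hx _
  have hinner : ∀ m, ∑' k, (a (j - k) : 𝕜) * ((c (k - m) : 𝕜) * x m)
      = if m = j then (C : 𝕜) * x m else 0 := by
    intro m
    have e1 : ∀ k, (a (j - (k + m)) : 𝕜) * ((c (k + m - m) : 𝕜) * x m)
        = ((a (j - m - k) * c k : ℝ) : 𝕜) * x m := fun k => by
      rw [add_sub_cancel_right, RCLike.ofReal_mul, sub_sub, add_comm k m, mul_assoc]
    have e2 := (Equiv.addRight m).tsum_eq fun k => (a (j - k) : 𝕜) * ((c (k - m) : 𝕜) * x m)
    simp only [Equiv.coe_addRight, e1] at e2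
    rw [← e2, tsum_mul_right, ← RCLike.ofReal_tsum, h]
    by_cases hm : m = j
    · rw [hm, sub_self, if_pos rfl, if_pos rfl]
    · rw [if_neg (sub_ne_zero.2 (Ne.symm hm)), if_neg hm, RCLike.ofReal_zero, zero_mul]
  simp_rw [← tsum_mul_left]
  rw [← Summable.tsum_comm (f := fun k m => (a (j - k) : 𝕜) * ((c (k - m) : 𝕜) * x m)) hsum]
  simp_rw [hinner]
  exact tsum_ite_eq j fun m => (C : 𝕜) * x m

/-- A bounded solution `x` of `a * x = y` is determined by `y` when `a` has an absolutely summable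
convolution inverse `c`. -/
theorem eq_of_conv_eq {G : Type*} [AddCommGroup G] [DecidableEq G] {a c : G → ℝ}
    (ha : Summable fun k => |a k|) (hc : Summable fun k => |c k|)
    (h : ∀ j, ∑' k, a (j - k) * c k = if j = 0 then 1 else 0)
    {x y : G → ℝ} {M N : ℝ} (hx : ∀ k, |x k| ≤ M) (hy : ∀ k, |y k| ≤ N)
    (hxy : ∀ j, ∑' k, a (j - k) * x k = ∑' k, a (j - k) * y k) : x = y := by
  have h' : ∀ j, ∑' k, c (j - k) * a k = if j = 0 then (1 : ℝ) else 0 := fun j => by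
    rw [← h, ← (Equiv.subLeft j).tsum_eq]
    simp [mul_comm]
  funext j
  have hX := tsum_conv_conv (𝕜 := ℝ) hc ha h' hx j
  have hY := tsum_conv_conv (𝕜 := ℝ) hc ha h' hy j
  simp only [RCLike.ofReal_real_eq_id, id_eq, one_mul] at hX hY
  rw [← hX, ← hY]
  simp_rw [hxy]

theorem exists_abs_le_of_summable_sq {ι : Type*} {x : ι → ℝ} (hx : Summable fun k => x k ^ 2) :
    ∃ M, ∀ k, |x k| ≤ M :=
  ⟨√(∑' k, x k ^ 2), fun k => Real.abs_le_sqrt (hx.le_tsum k fun _ _ => sq_nonneg _)⟩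

theorem summable_sq_of_summable_abs {ι : Type*} {x : ι → ℝ} (hx : Summable fun k => |x k|) :
    Summable fun k => x k ^ 2 := by
  refine Summable.of_nonneg_of_le (fun _ => sq_nonneg _) (fun k => ?_)
    (hx.mul_left (∑' k, |x k|))
  rw [← sq_abs, sq]
  gcongr
  exact hx.le_tsum k fun _ _ => abs_nonneg _

/-! ### Sums of products over a finite power -/

/-- Distributivity for absolutely convergent series:
`∑_{k ∈ ι^d} ∏ i, f i (k i) = ∏ i, ∑_{k ∈ ι} f i k`. -/
theorem hasSum_pi_prod {ι 𝕜 : Type*} [RCLike 𝕜] (d : ℕ) (f : Fin d → ι → 𝕜)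
    (hf : ∀ i, Summable fun k => ‖f i k‖) :
    (Summable fun k : Fin d → ι => ‖∏ i, f i (k i)‖) ∧
      HasSum (fun k : Fin d → ι => ∏ i, f i (k i)) (∏ i, ∑' k, f i k) := by
  induction d with
  | zero => exact ⟨(hasSum_fintype _).summable, by simp⟩
  | succ d ih =>
    obtain ⟨h1, h2⟩ := ih (fun i => f i.succ) fun i => hf _
    have hn := (Summable.mul_norm (hf 0) h1)
    have hs := (hf 0).of_norm.hasSum.mul h2 hn.of_norm
    have key : ∀ q : ι × (Fin d → ι), ∏ i, f i ((Fin.consEquiv fun _ => ι) q i)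
        = f 0 q.1 * ∏ i : Fin d, f i.succ (q.2 i) := fun q => by
      simp [Fin.prod_univ_succ, Fin.consEquiv]
    constructor
    · rw [← (Fin.consEquiv fun _ => ι).summable_iff]
      simpa only [Function.comp_def, key] using hn
    · rw [← (Fin.consEquiv fun _ => ι).hasSum_iff, Fin.prod_univ_succ]
      simpa only [Function.comp_def, key] using hs

/-! ### Convolution operators on `ℓ^p` -/

section Operators

variable {𝕜 : Type} [RCLike 𝕜] {p : ℝ≥0∞} [Fact (1 ≤ p)]

/-- Translation by `n` is a bounded operator on `ℓ^p`, of norm at most one. -/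
theorem exists_shift (n : ℤ) : ∃ U : lp (fun _ : ℤ => 𝕜) p →L[𝕜] lp (fun _ : ℤ => 𝕜) p,
    ‖U‖ ≤ 1 ∧ ∀ x j, U x j = x (j - n) := by
  have hp1 : 1 ≤ p := Fact.out
  have hp0 : p ≠ 0 := (zero_lt_one.trans_le hp1).ne'
  have key : ∀ x : lp (fun _ : ℤ => 𝕜) p, ∃ hm : Memℓp (fun j => x (j - n)) p,
      ‖(⟨fun j => x (j - n), hm⟩ : lp (fun _ : ℤ => 𝕜) p)‖ ≤ ‖x‖ := by
    intro x
    rcases eq_or_ne p ∞ with rfl | hp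
    · have hm : Memℓp (fun j => x (j - n)) ∞ :=
        memℓp_infty ⟨‖x‖, by rintro _ ⟨j, rfl⟩; exact lp.norm_apply_le_norm hp0 x _⟩
      exact ⟨hm, lp.norm_le_of_forall_le (norm_nonneg _)
        fun j => lp.norm_apply_le_norm hp0 x _⟩
    · have hpp : 0 < p.toReal := ENNReal.toReal_pos hp0 hp
      have hs := (Equiv.subRight n).hasSum_iff.2 (lp.hasSum_norm hpp x)
      exact ⟨memℓp_gen hs.summable, lp.norm_le_of_tsum_le hpp (norm_nonneg _) hs.tsum_eq.le⟩
  choose hm hle using key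
  let L : lp (fun _ : ℤ => 𝕜) p →ₗ[𝕜] lp (fun _ : ℤ => 𝕜) p :=
    { toFun := fun x => ⟨fun j => x (j - n), hm x⟩
      map_add' := fun x y => rfl
      map_smul' := fun r x => rfl }
  exact ⟨L.mkContinuous 1 fun x => (hle x).trans_eq (one_mul _).symm,
    L.mkContinuous_norm_le zero_le_one _, fun x j => rfl⟩

/-- An absolutely summable sequence acts on `ℓ^p` by convolution, as the norm convergent
superposition `∑ a n • (shift by n)`. -/
theorem exists_isToeplitz {a : ℤ → ℝ} (ha : Summable fun k => |a k|) :
    ∃ T : lp (fun _ : ℤ => 𝕜) p →L[𝕜] lp (fun _ : ℤ => 𝕜) p,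
      IsToeplitz a T ∧ ‖T‖ ≤ ∑' k, |a k| := by
  choose U hU hUx using fun n : ℤ => exists_shift (𝕜 := 𝕜) (p := p) n
  have hle : ∀ n, ‖(a n : 𝕜) • U n‖ ≤ |a n| := fun n => by
    rw [norm_smul, RCLike.norm_ofReal]
    exact mul_le_of_le_one_right (abs_nonneg _) (hU n)
  have hs : Summable fun n => (a n : 𝕜) • U n := .of_norm_bounded ha hle
  refine ⟨∑' n, (a n : 𝕜) • U n, fun x j => ?_, tsum_of_norm_bounded ha.hasSum hle⟩
  have h1 := ((lp.evalCLM 𝕜 (fun _ : ℤ => 𝕜) p j).comp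
    (ContinuousLinearMap.apply 𝕜 (lp (fun _ : ℤ => 𝕜) p) x)).hasSum hs.hasSum
  have h2 := (Equiv.subLeft j).hasSum_iff.2 h1
  have h3 : (fun k : ℤ => (a (j - k) : 𝕜) * x k) = fun k => (a (j - k) : 𝕜) * U (j - k) x j := by
    funext k
    rw [hUx, sub_sub_cancel]
  rw [h3]
  exact h2

/-- The damped alternating sequence `x k = (-1)^k r^|k|` is nearly extremal for every `p` at once,
as `r → 1`: where `a` alternates, `‖(a * x) j‖ ≥ (∑_{m ∈ F} |a m| r^|m|) ‖x j‖` for each `j` and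
each finite `F`, because `r^|j - m| ≥ r^|j| r^|m|`. -/
theorem tsum_abs_le_norm_of_isToeplitz {a : ℤ → ℝ} (ha : Summable fun k => |a k|)
    (hsign : ∀ k : ℤ, 0 ≤ (-1 : ℝ) ^ k * a k)
    {T : lp (fun _ : ℤ => 𝕜) p →L[𝕜] lp (fun _ : ℤ => 𝕜) p} (hT : IsToeplitz a T) :
    ∑' k, |a k| ≤ ‖T‖ := by
  have hp1 : 1 ≤ p := Fact.out
  have hp0 : p ≠ 0 := (zero_lt_one.trans_le hp1).ne'
  have habs : ∀ k : ℤ, (-1 : ℝ) ^ k * a k = |a k| := fun k => by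
    rw [← abs_of_nonneg (hsign k), abs_mul]
    simp
  refine ha.tsum_le_of_sum_le fun F => ?_
  have hr : ∀ r : ℝ, 0 < r → r < 1 → ∑ m ∈ F, |a m| * r ^ m.natAbs ≤ ‖T‖ := by
    intro r hr0 hr1
    have hgeo : Summable fun k : ℤ => r ^ k.natAbs := by
      refine summable_int_iff_summable_nat_and_neg.2 ⟨?_, ?_⟩ <;>
        simpa using summable_geometric_of_lt_one hr0.le hr1
    have hn : ∀ k : ℤ, ‖((((-1 : ℝ) ^ k * r ^ k.natAbs : ℝ)) : 𝕜)‖ = r ^ k.natAbs := fun k => by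
      rw [RCLike.norm_ofReal, abs_mul, abs_of_pos (pow_pos hr0 _)]
      simp
    have hmem : Memℓp (fun k : ℤ => (((-1 : ℝ) ^ k * r ^ k.natAbs : ℝ) : 𝕜)) p := by
      refine Memℓp.of_exponent_ge (q := 1) (memℓp_gen ?_) hp1
      simpa only [hn, ENNReal.toReal_one, Real.rpow_one] using hgeo
    let x : lp (fun _ : ℤ => 𝕜) p := ⟨_, hmem⟩
    have hxk : ∀ k : ℤ, x k = (((-1 : ℝ) ^ k * r ^ k.natAbs : ℝ) : 𝕜) := fun k => rfl
    have hx0 : 0 < ‖x‖ := by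
      refine lt_of_lt_of_le ?_ (lp.norm_apply_le_norm hp0 x 0)
      rw [hxk, hn]
      simp
    set s := ∑ m ∈ F, |a m| * r ^ m.natAbs with hs
    have hs0 : 0 ≤ s := Finset.sum_nonneg fun m _ => by positivity
    have hpt : ∀ j : ℤ, ‖((s : 𝕜) • x) j‖ ≤ ‖T x j‖ := by
      intro j
      have e1 : T x j = ((∑' m : ℤ, |a m| * r ^ (j - m).natAbs : ℝ) : 𝕜) * ((-1 : ℝ) ^ j : ℝ) := by
        rw [← (hT x j).tsum_eq, ← (Equiv.subLeft j).tsum_eq, RCLike.ofReal_tsum, ← tsum_mul_right]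
        refine tsum_congr fun m => ?_
        simp only [Equiv.subLeft_apply, sub_sub_cancel, hxk]
        rw [← RCLike.ofReal_mul, ← RCLike.ofReal_mul, ← habs m, zpow_sub₀ (by norm_num)]
        congr 1
        have : ((-1 : ℝ) ^ m)⁻¹ = (-1) ^ m := by
          rw [← inv_zpow]
          norm_num
        rw [div_eq_mul_inv, this]
        ring
      have e2 : s * r ^ j.natAbs ≤ ∑' m : ℤ, |a m| * r ^ (j - m).natAbs := by
        rw [hs, Finset.sum_mul]
        refine le_trans (Finset.sum_le_sum fun m _ => ?_)
          (Summable.sum_le_tsum (f := fun m : ℤ => |a m| * r ^ (j - m).natAbs) F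
            (fun m _ => by positivity) ?_)
        · rw [mul_assoc, ← pow_add]
          refine mul_le_mul_of_nonneg_left ?_ (abs_nonneg _)
          exact pow_le_pow_of_le_one hr0.le hr1.le (by omega)
        · refine Summable.of_nonneg_of_le (fun m => by positivity) (fun m => ?_) ha
          exact mul_le_of_le_one_right (abs_nonneg _) (pow_le_one₀ hr0.le hr1.le)
      have e3 : ((s : 𝕜) • x) j = (s : 𝕜) * x j := rfl
      rw [e3, e1, norm_mul, norm_mul, hxk, hn, RCLike.norm_ofReal, RCLike.norm_ofReal,
        RCLike.norm_ofReal, abs_of_nonneg hs0]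
      have : |(-1 : ℝ) ^ j| = 1 := by simp
      rw [this, mul_one]
      exact e2.trans (le_abs_self _)
    have h1 := lp.norm_mono hp0 hpt
    rw [norm_smul, RCLike.norm_ofReal, abs_of_nonneg hs0] at h1
    exact le_of_mul_le_mul_right (h1.trans (T.le_opNorm x)) hx0
  have hcont : Filter.Tendsto (fun r : ℝ => ∑ m ∈ F, |a m| * r ^ m.natAbs) (nhdsWithin 1 (Set.Iio 1))
      (nhds (∑ m ∈ F, |a m| * 1 ^ m.natAbs)) :=
    Filter.Tendsto.mono_left (Continuous.tendsto (by fun_prop) 1) nhdsWithin_le_nhds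
  simp only [one_pow, mul_one] at hcont
  refine le_of_tendsto hcont ?_
  filter_upwards [Ioo_mem_nhdsLT (zero_lt_one' ℝ)] with r hr' using hr r hr'.1 hr'.2

theorem toeplitz_comp_eq_id {a c : ℤ → ℝ} (ha : Summable fun k => |a k|)
    (hc : Summable fun k => |c k|) (h : ∀ j, ∑' k, a (j - k) * c k = if j = 0 then 1 else 0)
    {A B : lp (fun _ : ℤ => 𝕜) p →L[𝕜] lp (fun _ : ℤ => 𝕜) p}
    (hA : IsToeplitz a A) (hB : IsToeplitz c B) (x : lp (fun _ : ℤ => 𝕜) p) : A (B x) = x := by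
  have hp0 : p ≠ 0 := (zero_lt_one.trans_le (Fact.out : 1 ≤ p)).ne'
  refine lp.ext (funext fun j => ?_)
  have := tsum_conv_conv ha hc h (lp.norm_apply_le_norm hp0 x) j
  rw [RCLike.ofReal_one, one_mul] at this
  rw [← this, ← (hA (B x) j).tsum_eq]
  simp_rw [(hB x _).tsum_eq]

/-- Convolution by an absolutely summable sequence with an absolutely summable alternating
convolution inverse is boundedly invertible, and the norm of its inverse is computed exactly. -/
theorem exists_toeplitz_equiv {a c : ℤ → ℝ} (ha : Summable fun k => |a k|)
    (hc : Summable fun k => |c k|) (h : ∀ j, ∑' k, a (j - k) * c k = if j = 0 then 1 else 0)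
    (hsign : ∀ k : ℤ, 0 ≤ (-1 : ℝ) ^ k * c k) :
    ∃ A : lp (fun _ : ℤ => 𝕜) p ≃L[𝕜] lp (fun _ : ℤ => 𝕜) p,
      IsToeplitz a (A : lp (fun _ : ℤ => 𝕜) p →L[𝕜] lp (fun _ : ℤ => 𝕜) p) ∧
      IsToeplitz c (A.symm : lp (fun _ : ℤ => 𝕜) p →L[𝕜] lp (fun _ : ℤ => 𝕜) p) ∧
      ‖(A.symm : lp (fun _ : ℤ => 𝕜) p →L[𝕜] lp (fun _ : ℤ => 𝕜) p)‖ = ∑' k : ℤ, |c k| := by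
  obtain ⟨A, hA, -⟩ := exists_isToeplitz (𝕜 := 𝕜) (p := p) ha
  obtain ⟨B, hB, hBn⟩ := exists_isToeplitz (𝕜 := 𝕜) (p := p) hc
  have h' : ∀ j, ∑' k, c (j - k) * a k = if j = 0 then (1 : ℝ) else 0 := fun j => by
    rw [← h, ← (Equiv.subLeft j).tsum_eq]
    simp [mul_comm]
  refine ⟨ContinuousLinearEquiv.equivOfInverse A B (toeplitz_comp_eq_id hc ha h' hB hA)
    (toeplitz_comp_eq_id ha hc h hA hB), hA, hB, ?_⟩
  exact hBn.antisymm (tsum_abs_le_norm_of_isToeplitz hc hsign hB)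

end Operators

/-! ### The univariate cardinal coefficients -/

/-- The alternating tail `S m = ∑_{n ≥ 0} (-1)^n exp (-lam (m + n + 1/2)^2)`. -/
noncomputable def altTail (lam : ℝ) (m : ℕ) : ℝ :=
  ∑' n : ℕ, (-1 : ℝ) ^ n * Real.exp (-lam * (m + n + 1 / 2) ^ 2)

/-- The cardinal coefficients before normalisation, `(-1)^k exp (lam k^2) S |k|`. -/
noncomputable def rawCoeff (lam : ℝ) (k : ℤ) : ℝ :=
  (-1 : ℝ) ^ k * Real.exp (lam * k ^ 2) * altTail lam k.natAbs

/-- The normalising constant `∑ k, (-1)^k S |k|`. -/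
noncomputable def rawConst (lam : ℝ) : ℝ :=
  ∑' k : ℤ, (-1 : ℝ) ^ k * altTail lam k.natAbs

variable {lam : ℝ}

theorem summable_exp_neg_natAbs (hlam : 0 < lam) :
    Summable fun k : ℤ => Real.exp (-lam * k.natAbs) := by
  have h : Summable fun n : ℕ => Real.exp (-lam * n) := by
    have := summable_geometric_of_lt_one (Real.exp_pos (-lam)).le
      (by simpa using hlam)
    refine this.congr fun n => ?_
    rw [← Real.exp_nat_mul, mul_comm]
  refine summable_int_iff_summable_nat_and_neg.2 ⟨?_, ?_⟩ <;> simpa using h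

theorem summable_altTail_terms (hlam : 0 < lam) (m : ℕ) :
    Summable fun n : ℕ => (-1 : ℝ) ^ n * Real.exp (-lam * (m + n + 1 / 2) ^ 2) := by
  have h : Summable fun n : ℕ => Real.exp (-lam * n) := by
    simpa using (summable_int_iff_summable_nat_and_neg.1 (summable_exp_neg_natAbs hlam)).1
  refine Summable.of_norm_bounded h fun n => ?_
  rw [norm_mul, norm_pow, norm_neg, norm_one, one_pow, one_mul, Real.norm_eq_abs, Real.abs_exp,
    Real.exp_le_exp]
  have hm : (0 : ℝ) ≤ m := m.cast_nonneg
  have hn : (0 : ℝ) ≤ n := n.cast_nonneg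
  have : (n : ℝ) ≤ (m + n + 1 / 2) ^ 2 := by nlinarith
  nlinarith

theorem antitone_altTail_terms (hlam : 0 < lam) (m : ℕ) :
    Antitone fun n : ℕ => Real.exp (-lam * (m + n + 1 / 2) ^ 2) := by
  refine antitone_nat_of_succ_le fun n => ?_
  rw [Real.exp_le_exp, neg_mul, neg_mul, neg_le_neg_iff]
  push_cast
  gcongr
  linarith

theorem altTail_le (hlam : 0 < lam) (m : ℕ) :
    altTail lam m ≤ Real.exp (-lam * (m + 1 / 2) ^ 2) := by
  have h := (antitone_altTail_terms hlam m).tendsto_le_alternating_series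
    (summable_altTail_terms hlam m).hasSum.tendsto_sum_nat 0
  simpa [altTail] using h

theorem altTail_pos (hlam : 0 < lam) (m : ℕ) : 0 < altTail lam m := by
  have h := (antitone_altTail_terms hlam m).alternating_series_le_tendsto
    (summable_altTail_terms hlam m).hasSum.tendsto_sum_nat 1
  refine lt_of_lt_of_le ?_ h
  have hm : (0 : ℝ) ≤ m := m.cast_nonneg
  have : Real.exp (-lam * (m + 1 + 1 / 2) ^ 2) < Real.exp (-lam * (m + 1 / 2) ^ 2) := by
    rw [Real.exp_lt_exp]
    nlinarith
  simp only [mul_one, Finset.sum_range_succ, Finset.sum_range_zero]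
  simp only [zero_add, pow_zero, one_mul, Nat.cast_zero, add_zero, pow_one, Nat.cast_one]
  linarith

theorem altTail_add_succ (hlam : 0 < lam) (m : ℕ) :
    altTail lam m + altTail lam (m + 1) = Real.exp (-lam * (m + 1 / 2) ^ 2) := by
  have h : altTail lam m = Real.exp (-lam * (m + 1 / 2) ^ 2) +
      ∑' n : ℕ, (-1 : ℝ) ^ (n + 1) * Real.exp (-lam * (m + (n + 1 : ℕ) + 1 / 2) ^ 2) := by
    rw [altTail, (summable_altTail_terms hlam m).tsum_eq_zero_add]
    simp
  have h2 : altTail lam (m + 1) =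
      -∑' n : ℕ, (-1 : ℝ) ^ (n + 1) * Real.exp (-lam * (m + (n + 1 : ℕ) + 1 / 2) ^ 2) := by
    rw [altTail, ← tsum_neg]
    refine tsum_congr fun n => ?_
    rw [pow_succ (-1 : ℝ)]
    push_cast
    rw [show (m : ℝ) + 1 + n + 1 / 2 = m + (n + 1) + 1 / 2 by ring]
    ring
  rw [h2, h]
  ring

/-- The recurrence for the alternating tails, in a form valid at all integers: the reflection
`k ↦ -1 - k` preserves `(k + 1/2)^2` and flips the sign `(-1)^k`. -/
theorem neg_one_zpow_mul_altTail_sub (hlam : 0 < lam) (k : ℤ) :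
    (-1 : ℝ) ^ k * altTail lam k.natAbs - (-1 : ℝ) ^ (k + 1) * altTail lam (k + 1).natAbs
      = (-1 : ℝ) ^ k * Real.exp (-lam * (k + 1 / 2) ^ 2) := by
  rw [zpow_add_one₀ (by norm_num)]
  rcases Int.eq_ofNat_of_zero_le (a := if 0 ≤ k then k else -k - 1) (by split_ifs <;> omega)
    with ⟨n, hn⟩
  split_ifs at hn with h
  · have e1 : k.natAbs = n := by omega
    have e2 : (k + 1).natAbs = n + 1 := by omega
    have := altTail_add_succ hlam n
    rw [e1, e2, hn, Int.cast_natCast, ← this]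
    ring
  · have e1 : k.natAbs = n + 1 := by omega
    have e2 : (k + 1).natAbs = n := by omega
    have e3 : (k : ℝ) + 1 / 2 = -(n + 1 / 2) := by
      have : k = -(n : ℤ) - 1 := by omega
      rw [this]
      push_cast
      ring
    have := altTail_add_succ hlam n
    rw [e1, e2, e3, neg_sq, ← this]
    ring

theorem abs_rawCoeff_le (hlam : 0 < lam) (k : ℤ) :
    |rawCoeff lam k| ≤ Real.exp (-lam * k.natAbs) := by
  have h1 : |rawCoeff lam k| = Real.exp (lam * k ^ 2) * altTail lam k.natAbs := by
    rw [rawCoeff, abs_mul, abs_mul, Real.abs_exp, abs_of_pos (altTail_pos hlam _)]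
    simp
  rw [h1]
  refine (mul_le_mul_of_nonneg_left (altTail_le hlam _) (Real.exp_pos _).le).trans ?_
  rw [← Real.exp_add, Real.exp_le_exp]
  have h2 : (k : ℝ) ^ 2 = (k.natAbs : ℝ) ^ 2 := by
    rw [Nat.cast_natAbs, Int.cast_abs, sq_abs]
  rw [h2]
  nlinarith

theorem summable_abs_rawCoeff (hlam : 0 < lam) : Summable fun k => |rawCoeff lam k| :=
  .of_nonneg_of_le (fun _ => abs_nonneg _) (abs_rawCoeff_le hlam) (summable_exp_neg_natAbs hlam)

theorem abs_gaussian (x : ℝ) : |gaussian lam x| = gaussian lam x := Real.abs_exp _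

theorem natAbs_le_sq (k : ℤ) : (k.natAbs : ℝ) ≤ (k : ℝ) ^ 2 := by
  have h : (k.natAbs : ℝ) ≤ (k.natAbs : ℝ) ^ 2 := by
    exact_mod_cast Nat.le_self_pow two_ne_zero _
  rwa [Nat.cast_natAbs, Int.cast_abs, sq_abs, ← Int.cast_abs, ← Nat.cast_natAbs] at h

theorem summable_gaussian (hlam : 0 < lam) : Summable fun k : ℤ => |gaussian lam k| := by
  refine .of_nonneg_of_le (fun _ => abs_nonneg _) (fun k => ?_) (summable_exp_neg_natAbs hlam)
  rw [abs_gaussian, gaussian, Real.exp_le_exp]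
  have h2 := natAbs_le_sq k
  nlinarith

theorem gaussian_mul_rawCoeff (j k : ℤ) : gaussian lam ((j - k : ℤ) : ℝ) * rawCoeff lam k
    = Real.exp (-lam * j ^ 2) *
      (Real.exp (2 * lam * j * k) * ((-1 : ℝ) ^ k * altTail lam k.natAbs)) := by
  have : Real.exp (-lam * ((j - k : ℤ) : ℝ) ^ 2) * Real.exp (lam * k ^ 2)
      = Real.exp (-lam * j ^ 2) * Real.exp (2 * lam * j * k) := by
    rw [← Real.exp_add, ← Real.exp_add]
    push_cast
    ring_nf
  rw [gaussian, rawCoeff]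
  linear_combination ((-1 : ℝ) ^ k * altTail lam k.natAbs) * this

/-- A Gaussian centred at a half-integer, sampled with alternating signs, sums to zero: reflect
about the centre. -/
theorem tsum_alternating_gaussian_eq_zero (lam : ℝ) (j : ℤ) :
    ∑' k : ℤ, (-1 : ℝ) ^ k * Real.exp (-lam * (k + 1 / 2 - j) ^ 2) = 0 := by
  have h := (Equiv.subLeft (2 * j - 1)).tsum_eq fun k : ℤ =>
    (-1 : ℝ) ^ k * Real.exp (-lam * (k + 1 / 2 - j) ^ 2)
  have e : ∀ k : ℤ, (-1 : ℝ) ^ (2 * j - 1 - k) *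
      Real.exp (-lam * (((2 * j - 1 - k : ℤ) : ℝ) + 1 / 2 - j) ^ 2)
      = -((-1 : ℝ) ^ k * Real.exp (-lam * (k + 1 / 2 - j) ^ 2)) := by
    intro k
    have h1 : (-1 : ℝ) ^ (2 * j - 1 - k) = -(-1 : ℝ) ^ k := by
      rw [zpow_sub₀ (by norm_num), zpow_sub₀ (by norm_num), zpow_mul]
      have : ((-1 : ℝ) ^ k)⁻¹ = (-1) ^ k := by
        rw [← inv_zpow]
        norm_num
      rw [div_eq_mul_inv _ ((-1 : ℝ) ^ k), this]
      norm_num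
    have h2 : (((2 * j - 1 - k : ℤ) : ℝ) + 1 / 2 - j) ^ 2 = (k + 1 / 2 - j) ^ 2 := by
      push_cast
      ring
    rw [h1, h2, neg_mul]
  simp only [Equiv.subLeft_apply, e, tsum_neg] at h
  linarith

/-- The unnormalised coefficients invert the Gaussian up to the constant. For `j ≠ 0`, summation by
parts turns `∑ k, exp (2 lam j k) (-1)^k S |k|` into `tsum_alternating_gaussian_eq_zero`. -/
theorem gaussian_conv_rawCoeff (hlam : 0 < lam) (j : ℤ) :
    ∑' k : ℤ, gaussian lam ((j - k : ℤ) : ℝ) * rawCoeff lam k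
      = if j = 0 then rawConst lam else 0 := by
  split_ifs with hj
  · rw [rawConst]
    refine tsum_congr fun k => ?_
    rw [gaussian_mul_rawCoeff, hj]
    simp
  have hs : Summable fun k : ℤ =>
      Real.exp (2 * lam * j * k) * ((-1 : ℝ) ^ k * altTail lam k.natAbs) := by
    have h1 := summable_conv_mul (𝕜 := ℝ) (a := fun k : ℤ => gaussian lam k)
      (x := rawCoeff lam) (M := 1) (summable_gaussian hlam)
      (fun k => (abs_rawCoeff_le hlam k).trans (Real.exp_le_one_iff.2 ?_)) j
    · simp only [RCLike.ofReal_real_eq_id, id_eq, gaussian_mul_rawCoeff] at h1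
      exact (summable_mul_left_iff (Real.exp_pos _).ne').1 h1
    · have : (0 : ℝ) ≤ k.natAbs := Nat.cast_nonneg _
      nlinarith
  simp_rw [gaussian_mul_rawCoeff, tsum_mul_left]
  set T := ∑' k : ℤ, Real.exp (2 * lam * j * k) * ((-1 : ℝ) ^ k * altTail lam k.natAbs) with hT
  have hshift : ∀ k : ℤ, Real.exp (2 * lam * j * k) *
      ((-1 : ℝ) ^ (k + 1) * altTail lam (k + 1).natAbs) = Real.exp (-(2 * lam * j)) *
      (Real.exp (2 * lam * j * (k + 1 : ℤ)) * ((-1 : ℝ) ^ (k + 1) * altTail lam (k + 1).natAbs)) := by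
    intro k
    rw [← mul_assoc (Real.exp (-(2 * lam * j))), ← Real.exp_add]
    congr 2
    push_cast
    ring
  have hs' := ((Equiv.addRight (1 : ℤ)).summable_iff.2 hs).mul_left (Real.exp (-(2 * lam * j)))
  have hT' := (Equiv.addRight (1 : ℤ)).tsum_eq fun k : ℤ =>
    Real.exp (2 * lam * j * k) * ((-1 : ℝ) ^ k * altTail lam k.natAbs)
  simp only [Function.comp_def, Equiv.coe_addRight, ← hshift] at hs'
  simp only [Equiv.coe_addRight] at hT'
  have hdiff := hs.tsum_sub hs'
  have h0 : ∀ k : ℤ, Real.exp (2 * lam * j * k) * ((-1 : ℝ) ^ k * altTail lam k.natAbs) -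
      Real.exp (2 * lam * j * k) * ((-1 : ℝ) ^ (k + 1) * altTail lam (k + 1).natAbs)
      = Real.exp (lam * j ^ 2 - lam * j) * ((-1 : ℝ) ^ k *
        Real.exp (-lam * (k + 1 / 2 - j) ^ 2)) := by
    intro k
    rw [← mul_sub, neg_one_zpow_mul_altTail_sub hlam, mul_left_comm, mul_left_comm (Real.exp _),
      ← Real.exp_add, ← Real.exp_add]
    congr 2
    ring
  simp_rw [h0] at hdiff
  rw [tsum_mul_left, tsum_alternating_gaussian_eq_zero, mul_zero] at hdiff
  simp_rw [hshift] at hdiff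
  rw [tsum_mul_left, hT', ← hT] at hdiff
  have hne : Real.exp (-(2 * lam * j)) ≠ 1 := by
    rw [Ne, Real.exp_eq_one_iff, neg_eq_zero]
    have : (j : ℝ) ≠ 0 := by exact_mod_cast hj
    positivity
  have : T = 0 := by
    have h3 : T * (1 - Real.exp (-(2 * lam * j))) = 0 := by linear_combination -hdiff
    exact (mul_eq_zero.1 h3).resolve_right (sub_ne_zero.2 hne.symm)
  rw [this, mul_zero]

/-! ### The Fourier side -/

/-- The Fourier series `∑ k, a k exp (-i k ξ)`. -/
noncomputable def fourierSeries (a : ℤ → ℝ) (ξ : ℝ) : ℂ :=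
  ∑' k : ℤ, (a k : ℂ) * Complex.exp (-Complex.I * (k * ξ : ℝ))

theorem norm_character (t : ℝ) : ‖Complex.exp (-Complex.I * (t : ℂ))‖ = 1 := by
  rw [Complex.norm_exp]
  simp

theorem fourierSeries_mul {a c : ℤ → ℝ} (ha : Summable fun k => |a k|)
    (hc : Summable fun k => |c k|) {C : ℝ}
    (h : ∀ j, ∑' k, a (j - k) * c k = if j = 0 then C else 0) (ξ : ℝ) :
    fourierSeries a ξ * fourierSeries c ξ = C := by
  let x : ℤ → ℂ := fun k => Complex.exp (-Complex.I * ((-k : ℤ) * ξ : ℝ))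
  have hconv : ∀ (b : ℤ → ℝ) (j : ℤ), ∑' k, (b (j - k) : ℂ) * x k = fourierSeries b ξ * x j := by
    intro b j
    rw [← (Equiv.subLeft j).tsum_eq, fourierSeries, ← tsum_mul_right]
    refine tsum_congr fun k => ?_
    simp only [Equiv.subLeft_apply, sub_sub_cancel, x]
    rw [mul_assoc, ← Complex.exp_add]
    congr 2
    push_cast
    ring
  have hx : ∀ k, ‖x k‖ ≤ 1 := fun k => (norm_character _).le
  have h1 := tsum_conv_conv (𝕜 := ℂ) ha hc h hx 0
  have h2 : x 0 = 1 := by simp [x]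
  simp only [Complex.coe_algebraMap] at h1
  simp_rw [hconv c] at h1
  have h3 : ∀ k, (a (0 - k) : ℂ) * (fourierSeries c ξ * x k)
      = fourierSeries c ξ * ((a (0 - k) : ℂ) * x k) := fun k => by ring
  simp_rw [h3] at h1
  rw [tsum_mul_left, hconv a, h2, mul_one, mul_one] at h1
  rw [← h1, mul_comm]

/-- Poisson summation for the Gaussian. -/
theorem tsum_hat_eq_fourierSeries (hlam : 0 < lam) (ξ : ℝ) :
    ∑' m : ℤ, ((Real.pi / lam : ℂ) ^ (1 / 2 : ℂ) *
      Complex.exp ((-Complex.I * ((ξ + 2 * Real.pi * m : ℝ) : ℂ)) ^ 2 / (4 * lam)))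
      = fourierSeries (fun k => gaussian lam k) ξ := by
  have hpi : (Real.pi : ℂ) ≠ 0 := by exact_mod_cast Real.pi_ne_zero
  have hl : (lam : ℂ) ≠ 0 := by exact_mod_cast hlam.ne'
  have hpos : 0 < lam / Real.pi := div_pos hlam Real.pi_pos
  have h := Complex.tsum_exp_neg_quadratic (a := ((lam / Real.pi : ℝ) : ℂ))
    (by rwa [Complex.ofReal_re]) (-Complex.I * ξ / (2 * Real.pi))
  have hc : 1 / ((lam / Real.pi : ℝ) : ℂ) ^ (1 / 2 : ℂ) = (Real.pi / lam : ℂ) ^ (1 / 2 : ℂ) := by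
    have e1 : ((1 / 2 : ℝ) : ℂ) = (1 / 2 : ℂ) := by norm_num
    rw [← e1, ← Complex.ofReal_cpow hpos.le, ← Complex.ofReal_div, ← Complex.ofReal_cpow
      (div_pos Real.pi_pos hlam).le, ← Complex.ofReal_one, ← Complex.ofReal_div, one_div,
      ← Real.inv_rpow hpos.le, inv_div]
  rw [tsum_mul_left, fourierSeries, ← hc]
  refine Eq.trans ?_ (h.symm.trans ?_)
  · congr 1
    refine tsum_congr fun m => ?_
    have e1 : -Complex.I * ((ξ + 2 * Real.pi * m : ℝ) : ℂ)
        = -2 * Real.pi * (Complex.I * (m + Complex.I * (-Complex.I * ξ / (2 * Real.pi)))) := by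
      rw [show Complex.I * (-Complex.I * (ξ : ℂ) / (2 * Real.pi)) = ξ / (2 * Real.pi) by
        linear_combination (-(ξ : ℂ) / (2 * Real.pi)) * Complex.I_mul_I]
      push_cast
      field_simp
      ring
    rw [e1, mul_pow, mul_pow, mul_pow, Complex.I_sq]
    congr 1
    push_cast
    field_simp
    ring
  · refine tsum_congr fun k => ?_
    rw [gaussian, Complex.ofReal_exp, ← Complex.exp_add]
    congr 1
    push_cast
    field_simp

theorem exp_hat_eq (lam x : ℝ) : Complex.exp ((-Complex.I * (x : ℂ)) ^ 2 / (4 * lam))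
    = (Real.exp (-x ^ 2 / (4 * lam)) : ℝ) := by
  rw [Complex.ofReal_exp, mul_pow, neg_sq, Complex.I_sq]
  push_cast
  ring_nf

theorem summable_exp_hat (hlam : 0 < lam) (ξ : ℝ) :
    Summable fun m : ℤ => Real.exp (-(ξ + 2 * Real.pi * m) ^ 2 / (4 * lam)) := by
  have hμ : 0 < Real.pi ^ 2 / (2 * lam) := by positivity
  refine .of_nonneg_of_le (fun _ => (Real.exp_pos _).le) (fun m => ?_)
    ((summable_exp_neg_natAbs hμ).mul_left (Real.exp (ξ ^ 2 / (4 * lam))))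
  rw [← Real.exp_add, Real.exp_le_exp]
  have h1 := mul_le_mul_of_nonneg_left (natAbs_le_sq m) hμ.le
  have h2 : -(ξ + 2 * Real.pi * m) ^ 2 / (4 * lam) =
      ξ ^ 2 / (4 * lam) - Real.pi ^ 2 / (2 * lam) * m ^ 2
        - (ξ + Real.pi * m) ^ 2 / (2 * lam) := by
    field_simp
    ring
  have h3 : 0 ≤ (ξ + Real.pi * m) ^ 2 / (2 * lam) := by positivity
  rw [h2]
  linarith

theorem fourierSeries_gaussian_pos (hlam : 0 < lam) (ξ : ℝ) :
    ∃ r : ℝ, 0 < r ∧ fourierSeries (fun k => gaussian lam k) ξ = r := by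
  refine ⟨(Real.pi / lam) ^ (1 / 2 : ℝ) *
    ∑' m : ℤ, Real.exp (-(ξ + 2 * Real.pi * m) ^ 2 / (4 * lam)), mul_pos ?_ ?_, ?_⟩
  · exact Real.rpow_pos_of_pos (div_pos Real.pi_pos hlam) _
  · exact (summable_exp_hat hlam ξ).tsum_pos (fun _ => (Real.exp_pos _).le) 0 (Real.exp_pos _)
  · rw [← tsum_hat_eq_fourierSeries hlam, tsum_mul_left, Complex.ofReal_mul, Complex.ofReal_tsum,
      Complex.ofReal_cpow (div_pos Real.pi_pos hlam).le]
    simp_rw [exp_hat_eq]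
    push_cast
    rfl

/-- At `ξ = π` both Fourier series have a positive value, and their product is the constant. -/
theorem rawConst_pos (hlam : 0 < lam) : 0 < rawConst lam := by
  have h := fourierSeries_mul (summable_gaussian hlam) (summable_abs_rawCoeff hlam)
    (gaussian_conv_rawCoeff hlam) Real.pi
  have h1 : fourierSeries (rawCoeff lam) Real.pi = ((∑' k, |rawCoeff lam k| : ℝ) : ℂ) := by
    rw [fourierSeries, Complex.ofReal_tsum]
    refine tsum_congr fun k => ?_
    have e1 : Complex.exp (-Complex.I * ((k * Real.pi : ℝ) : ℂ)) = (((-1 : ℝ) ^ k : ℝ) : ℂ) := by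
      rw [show -Complex.I * ((k * Real.pi : ℝ) : ℂ) = k * (-(Real.pi * Complex.I)) by
        push_cast; ring, Complex.exp_int_mul, Complex.exp_neg, Complex.exp_pi_mul_I]
      norm_num
    have e2 : |rawCoeff lam k| = rawCoeff lam k * (-1 : ℝ) ^ k := by
      have e3 : ((-1 : ℝ) ^ k) * (-1 : ℝ) ^ k = 1 := by
        rw [← mul_zpow]
        norm_num
      rw [rawCoeff, abs_mul, abs_mul, Real.abs_exp, abs_of_pos (altTail_pos hlam _), abs_zpow,
        abs_neg, abs_one, one_zpow, one_mul]
      linear_combination -(Real.exp (lam * k ^ 2) * altTail lam k.natAbs) * e3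
    rw [e1, e2, Complex.ofReal_mul]
  obtain ⟨r, hr, hr'⟩ := fourierSeries_gaussian_pos hlam Real.pi
  rw [hr', h1, ← Complex.ofReal_mul, Complex.ofReal_inj] at h
  rw [← h]
  refine mul_pos hr ((summable_abs_rawCoeff hlam).tsum_pos (fun _ => abs_nonneg _) 0 (abs_pos.2 ?_))
  simpa [rawCoeff] using (altTail_pos hlam 0).ne'

/-! ### The normalised coefficients and their tensor powers -/

/-- The univariate cardinal coefficients in closed form. -/
noncomputable def cardinalCoeff (lam : ℝ) (k : ℤ) : ℝ :=
  rawCoeff lam k / rawConst lam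

theorem summable_abs_cardinalCoeff (hlam : 0 < lam) : Summable fun k => |cardinalCoeff lam k| := by
  simp_rw [cardinalCoeff, abs_div]
  exact (summable_abs_rawCoeff hlam).div_const _

theorem gaussian_conv_cardinalCoeff (hlam : 0 < lam) (j : ℤ) :
    ∑' k : ℤ, gaussian lam ((j - k : ℤ) : ℝ) * cardinalCoeff lam k = if j = 0 then 1 else 0 := by
  simp_rw [cardinalCoeff, mul_div_assoc']
  rw [tsum_div_const, gaussian_conv_rawCoeff hlam, ite_div, zero_div,
    div_self (rawConst_pos hlam).ne']

theorem cardinalCoeff_sign (hlam : 0 < lam) (k : ℤ) :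
    0 ≤ (-1 : ℝ) ^ k * cardinalCoeff lam k := by
  have e : ((-1 : ℝ) ^ k) * (-1 : ℝ) ^ k = 1 := by
    rw [← mul_zpow]
    norm_num
  rw [cardinalCoeff, rawCoeff, mul_div_assoc', ← mul_assoc, ← mul_assoc, e, one_mul]
  exact (div_pos (mul_pos (Real.exp_pos _) (altTail_pos hlam _)) (rawConst_pos hlam)).le

theorem cardinalCoeff_neg (k : ℤ) : cardinalCoeff lam (-k) = cardinalCoeff lam k := by
  rw [cardinalCoeff, cardinalCoeff, rawCoeff, rawCoeff, zpow_neg, ← inv_zpow]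
  norm_num

theorem eq_cardinalCoeff_iff (hlam : 0 < lam) (c : ℤ → ℝ) :
    IsCardinalCoeff lam c ↔ c = cardinalCoeff lam := by
  have hchi : ∀ (c : ℤ → ℝ) (j : ℤ), chi lam c j
      = ∑' k : ℤ, gaussian lam ((j - k : ℤ) : ℝ) * c k := fun c j => by
    simp only [chi, mul_comm, Int.cast_sub]
  have hc := summable_abs_cardinalCoeff hlam
  constructor
  · intro h
    obtain ⟨M, hM⟩ := exists_abs_le_of_summable_sq h.sq_summable
    obtain ⟨N, hN⟩ := exists_abs_le_of_summable_sq (summable_sq_of_summable_abs hc)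
    refine eq_of_conv_eq (a := fun k : ℤ => gaussian lam k) (summable_gaussian hlam) hc
      (gaussian_conv_cardinalCoeff hlam) hM hN fun j => ?_
    rw [gaussian_conv_cardinalCoeff hlam, ← h.interpolates, hchi]
  · rintro rfl
    exact ⟨summable_sq_of_summable_abs hc, fun j => by
      rw [hchi, gaussian_conv_cardinalCoeff hlam]⟩

/-- The multivariate cardinal coefficients: the tensor power of the univariate ones. -/
noncomputable def cardinalCoeffD (lam : ℝ) (d : ℕ) (k : Fin d → ℤ) : ℝ :=
  ∏ i, cardinalCoeff lam (k i)

theorem gaussianD_eq_prod (lam : ℝ) (d : ℕ) (x : Fin d → ℝ) :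
    gaussianD lam d x = ∏ i, gaussian lam (x i) := by
  simp only [gaussianD, gaussian]
  rw [Finset.mul_sum, Real.exp_sum]

theorem summable_gaussianD (hlam : 0 < lam) (d : ℕ) :
    Summable fun k : Fin d → ℤ => |gaussianD lam d fun i => (k i : ℝ)| := by
  have := (hasSum_pi_prod d (fun _ (k : ℤ) => gaussian lam k) fun _ =>
    summable_gaussian hlam).1
  simpa only [gaussianD_eq_prod, Real.norm_eq_abs] using this

theorem summable_abs_cardinalCoeffD (hlam : 0 < lam) (d : ℕ) :
    Summable fun k : Fin d → ℤ => |cardinalCoeffD lam d k| :=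
  (hasSum_pi_prod d (fun _ (k : ℤ) => cardinalCoeff lam k) fun _ =>
    summable_abs_cardinalCoeff hlam).1

theorem gaussianD_conv_cardinalCoeffD (hlam : 0 < lam) (d : ℕ) (j : Fin d → ℤ) :
    ∑' k : Fin d → ℤ, gaussianD lam d (fun i => (((j - k) i : ℤ) : ℝ)) * cardinalCoeffD lam d k
      = if j = 0 then 1 else 0 := by
  have h := (hasSum_pi_prod d
    (fun i (k : ℤ) => gaussian lam ((j i - k : ℤ) : ℝ) * cardinalCoeff lam k) fun i => by
      simpa using (summable_conv_mul (𝕜 := ℝ) (a := fun k : ℤ => gaussian lam k)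
        (summable_gaussian hlam)
        (fun k => (summable_abs_cardinalCoeff hlam).le_tsum k fun _ _ => abs_nonneg _)
        (j i)).norm).2.tsum_eq
  simp only [gaussian_conv_cardinalCoeff hlam, Finset.prod_mul_distrib] at h
  simp only [gaussianD_eq_prod, cardinalCoeffD, Pi.sub_apply, h]
  rw [Fintype.prod_ite_zero]
  simp [funext_iff]

theorem eq_cardinalCoeffD_iff (hlam : 0 < lam) (d : ℕ) (c : (Fin d → ℤ) → ℝ) :
    IsCardinalCoeffD lam d c ↔ c = cardinalCoeffD lam d := by
  have hchi : ∀ (c : (Fin d → ℤ) → ℝ) (j : Fin d → ℤ), chiD lam d c (fun i => (j i : ℝ))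
      = ∑' k : Fin d → ℤ, gaussianD lam d (fun i => (((j - k) i : ℤ) : ℝ)) * c k := fun c j => by
    simp only [chiD, mul_comm, Int.cast_sub, Pi.sub_apply]
  have hc := summable_abs_cardinalCoeffD hlam d
  constructor
  · intro h
    obtain ⟨M, hM⟩ := exists_abs_le_of_summable_sq h.sq_summable
    obtain ⟨N, hN⟩ := exists_abs_le_of_summable_sq (summable_sq_of_summable_abs hc)
    refine eq_of_conv_eq (a := fun k : Fin d → ℤ => gaussianD lam d fun i => (k i : ℝ))
      (summable_gaussianD hlam d) hc (gaussianD_conv_cardinalCoeffD hlam d) hM hN fun j => ?_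
    rw [gaussianD_conv_cardinalCoeffD hlam, ← h.interpolates, hchi]
  · rintro rfl
    exact ⟨summable_sq_of_summable_abs hc, fun j => by
      rw [hchi, gaussianD_conv_cardinalCoeffD hlam]⟩

theorem cardinalCoeffD_sign (hlam : 0 < lam) (d : ℕ) (k : Fin d → ℤ) :
    0 ≤ (-1 : ℝ) ^ (∑ i, k i) * cardinalCoeffD lam d k := by
  have h : ∀ s : Finset (Fin d), (-1 : ℝ) ^ (∑ i ∈ s, k i) = ∏ i ∈ s, (-1 : ℝ) ^ k i := by
    intro s
    induction s using Finset.cons_induction with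
    | empty => simp
    | cons i s hi ih => rw [Finset.sum_cons, Finset.prod_cons, zpow_add₀ (by norm_num), ih]
  rw [h, cardinalCoeffD, ← Finset.prod_mul_distrib]
  exact Finset.prod_nonneg fun i _ => cardinalCoeff_sign hlam (k i)

/-! ### The Fourier integral -/

theorem symbolD_eq_prod (hlam : 0 < lam) (d : ℕ) (ξ : Fin d → ℝ) :
    symbolD lam d ξ = ∏ i, fourierSeries (fun k => gaussian lam k) (ξ i) := by
  have hhat : ∀ ξ : Fin d → ℝ, gaussianHatD lam d ξ = ∏ i, ((Real.pi / lam : ℂ) ^ (1 / 2 : ℂ) *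
      Complex.exp ((-Complex.I * (ξ i : ℂ)) ^ 2 / (4 * lam))) := by
    intro ξ
    rw [← GaussianFourier.integral_cexp_neg_sum_mul_add (b := fun _ : Fin d => (lam : ℂ))
      (fun _ => by simpa using hlam), gaussianHatD]
    congr 1
    funext x
    rw [gaussianD, Complex.ofReal_exp, ← Complex.exp_add]
    congr 1
    push_cast
    rw [neg_mul, Finset.mul_sum, Finset.mul_sum]
    congr 2
    funext i
    ring
  have h := (hasSum_pi_prod d (fun i (m : ℤ) => (Real.pi / lam : ℂ) ^ (1 / 2 : ℂ) *
      Complex.exp ((-Complex.I * ((ξ i + 2 * Real.pi * m : ℝ) : ℂ)) ^ 2 / (4 * lam))) fun i => by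
    simp_rw [norm_mul, exp_hat_eq, Complex.norm_real, Real.norm_eq_abs, Real.abs_exp]
    exact (summable_exp_hat hlam (ξ i)).mul_left _).2.tsum_eq
  simp only [symbolD, hhat, h, tsum_hat_eq_fourierSeries hlam]

theorem one_div_symbolD (hlam : 0 < lam) (d : ℕ) (ξ : Fin d → ℝ) :
    1 / symbolD lam d ξ = ∏ i, fourierSeries (cardinalCoeff lam) (ξ i) := by
  rw [symbolD_eq_prod hlam, one_div, ← Finset.prod_inv_distrib]
  refine Finset.prod_congr rfl fun i _ => ?_
  have h := fourierSeries_mul (a := fun k : ℤ => gaussian lam k) (summable_gaussian hlam)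
    (summable_abs_cardinalCoeff hlam) (gaussian_conv_cardinalCoeff hlam) (ξ i)
  exact inv_eq_of_mul_eq_one_right (by simpa using h)

theorem integral_character (n : ℤ) :
    ∫ ξ in Set.Icc (-Real.pi) Real.pi, Complex.exp (-Complex.I * (n * ξ : ℝ))
      = if n = 0 then 2 * Real.pi else 0 := by
  rw [MeasureTheory.integral_Icc_eq_integral_Ioc,
    ← intervalIntegral.integral_of_le (by linarith [Real.pi_pos])]
  split_ifs with hn
  · simp [hn]
    ring
  · have hne : -Complex.I * n ≠ 0 :=
      mul_ne_zero (neg_ne_zero.2 Complex.I_ne_zero) (by exact_mod_cast hn)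
    have h := integral_exp_mul_complex (a := -Real.pi) (b := Real.pi) hne
    have e : ∀ ξ : ℝ, -Complex.I * ((n * ξ : ℝ) : ℂ) = -Complex.I * n * ξ := fun ξ => by
      push_cast
      ring
    simp_rw [e]
    -- the antiderivative is `2 π`-periodic
    have e2 : Complex.exp (-Complex.I * n * ((-Real.pi : ℝ) : ℂ))
        = Complex.exp (-Complex.I * n * (Real.pi : ℂ)) := by
      rw [Complex.exp_eq_exp_iff_exists_int]
      exact ⟨n, by push_cast; ring⟩
    rw [h, e2, sub_self, zero_div, Complex.ofReal_zero]

theorem integral_fourierSeries_mul {c : ℤ → ℝ} (hc : Summable fun k => |c k|) (k : ℤ) :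
    ∫ ξ in Set.Icc (-Real.pi) Real.pi,
      fourierSeries c ξ * Complex.exp (-Complex.I * (k * ξ : ℝ)) = 2 * Real.pi * c (-k) := by
  have hF : ∀ (m : ℤ) (ξ : ℝ), (c m : ℂ) * Complex.exp (-Complex.I * (m * ξ : ℝ)) *
      Complex.exp (-Complex.I * (k * ξ : ℝ))
      = c m * Complex.exp (-Complex.I * (((m + k : ℤ) : ℝ) * ξ : ℝ)) := fun m ξ => by
    rw [mul_assoc, ← Complex.exp_add]
    congr 2
    push_cast
    ring
  simp_rw [fourierSeries, ← tsum_mul_right, hF]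
  rw [← (MeasureTheory.hasSum_integral_of_summable_integral_norm ?_ ?_).tsum_eq]
  · simp_rw [MeasureTheory.integral_const_mul, integral_character]
    rw [tsum_eq_single (-k)]
    · simp
      ring
    · intro m hm
      rw [if_neg (by omega), Complex.ofReal_zero, mul_zero]
  · intro m
    exact (Continuous.continuousOn (by fun_prop)).integrableOn_Icc
  · simp_rw [norm_mul, norm_character, mul_one, Complex.norm_real, Real.norm_eq_abs,
      MeasureTheory.integral_const]
    exact hc.const_smul _

theorem cardinalCoeffD_eq_fourierCoeffD (hlam : 0 < lam) (d : ℕ) (k : Fin d → ℤ) :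
    (cardinalCoeffD lam d k : ℂ) = fourierCoeffD lam d k := by
  have hint : ∀ ξ : Fin d → ℝ, (1 / symbolD lam d ξ) *
      Complex.exp (-Complex.I * ((∑ i, (k i : ℝ) * ξ i : ℝ) : ℂ))
      = ∏ i, fourierSeries (cardinalCoeff lam) (ξ i) *
        Complex.exp (-Complex.I * (k i * ξ i : ℝ)) := fun ξ => by
    rw [one_div_symbolD hlam, Complex.ofReal_sum, Finset.mul_sum, Complex.exp_sum,
      Finset.prod_mul_distrib]
  have hpi : (2 * Real.pi : ℂ) ≠ 0 :=
    mul_ne_zero two_ne_zero (by exact_mod_cast Real.pi_ne_zero)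
  simp_rw [fourierCoeffD, hint]
  rw [← Set.pi_univ_Icc, MeasureTheory.volume_pi, MeasureTheory.Measure.restrict_pi_pi,
    MeasureTheory.integral_fintype_prod_eq_prod fun i (t : ℝ) =>
      fourierSeries (cardinalCoeff lam) t * Complex.exp (-Complex.I * (k i * t : ℝ))]
  simp_rw [integral_fourierSeries_mul (summable_abs_cardinalCoeff hlam), cardinalCoeff_neg]
  rw [Finset.prod_mul_distrib, Finset.prod_const, Finset.card_univ, Fintype.card_fin,
    ← mul_assoc, one_div, inv_mul_cancel₀ (pow_ne_zero _ hpi), one_mul, cardinalCoeffD,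
    Complex.ofReal_prod]

end GaussianCardinal

theorem proposition5p5p1 (lam : ℝ) (hlam : 0 < lam) :
    -- the univariate coefficients exist and are unique
    (∃! c : ℤ → ℝ, GaussianCardinal.IsCardinalCoeff lam c) ∧
    (∀ c : ℤ → ℝ, GaussianCardinal.IsCardinalCoeff lam c →
      -- they alternate in sign and are absolutely summable
      (∀ k : ℤ, 0 ≤ (-1 : ℝ) ^ k * c k) ∧
      (Summable fun k => |c k|) ∧
      -- the Gaussian Toeplitz matrix is boundedly invertible on every `ℓ^p`, real or complex, with
      -- inverse matrix `(c (j - k))`, and the norm of the inverse does not depend on `p`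
      (∀ (𝕜 : Type) [RCLike 𝕜] (p : ℝ≥0∞) [Fact (1 ≤ p)],
        ∃ A : lp (fun _ : ℤ => 𝕜) p ≃L[𝕜] lp (fun _ : ℤ => 𝕜) p,
          GaussianCardinal.IsToeplitz (fun n : ℤ => GaussianCardinal.gaussian lam n)
            (A : lp (fun _ : ℤ => 𝕜) p →L[𝕜] lp (fun _ : ℤ => 𝕜) p) ∧
          GaussianCardinal.IsToeplitz c
            (A.symm : lp (fun _ : ℤ => 𝕜) p →L[𝕜] lp (fun _ : ℤ => 𝕜) p) ∧
          ‖(A.symm : lp (fun _ : ℤ => 𝕜) p →L[𝕜] lp (fun _ : ℤ => 𝕜) p)‖ = ∑' k : ℤ, |c k| ∧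
          ‖(A.symm : lp (fun _ : ℤ => 𝕜) p →L[𝕜] lp (fun _ : ℤ => 𝕜) p)‖ =
            ∑' k : ℤ, (-1 : ℝ) ^ k * c k)) ∧
    -- the multivariate coefficients exist, are unique, are given by the Fourier integral of the
    -- reciprocal of the symbol, and alternate in sign
    (∀ d : ℕ,
      (∃! c : (Fin d → ℤ) → ℝ, GaussianCardinal.IsCardinalCoeffD lam d c) ∧
      ∀ c : (Fin d → ℤ) → ℝ, GaussianCardinal.IsCardinalCoeffD lam d c →
        (∀ k : Fin d → ℤ, (c k : ℂ) = GaussianCardinal.fourierCoeffD lam d k) ∧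
        (∀ k : Fin d → ℤ, 0 ≤ (-1 : ℝ) ^ (∑ i, k i) * c k)) := by

  refine ⟨?_, ?_, fun d => ⟨?_, ?_⟩⟩
  · simp_rw [GaussianCardinal.eq_cardinalCoeff_iff hlam]
    exact existsUnique_eq
  · intro c hc
    obtain rfl := (GaussianCardinal.eq_cardinalCoeff_iff hlam c).1 hc
    have hsign := GaussianCardinal.cardinalCoeff_sign hlam
    have hsum := GaussianCardinal.summable_abs_cardinalCoeff hlam
    refine ⟨hsign, hsum, fun 𝕜 _ p _ => ?_⟩
    obtain ⟨A, hA, hA', hn⟩ := GaussianCardinal.exists_toeplitz_equiv (𝕜 := 𝕜) (p := p)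
      (a := fun n : ℤ => GaussianCardinal.gaussian lam n)
      (GaussianCardinal.summable_gaussian hlam) hsum
      (GaussianCardinal.gaussian_conv_cardinalCoeff hlam) hsign
    refine ⟨A, hA, hA', hn, hn.trans (tsum_congr fun k => ?_)⟩
    rw [← abs_of_nonneg (hsign k), abs_mul]
    simp
  · simp_rw [GaussianCardinal.eq_cardinalCoeffD_iff hlam]
    exact existsUnique_eq
  · intro c hc
    obtain rfl := (GaussianCardinal.eq_cardinalCoeffD_iff hlam d c).1 hc
    exact ⟨GaussianCardinal.cardinalCoeffD_eq_fourierCoeffD hlam d,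
      GaussianCardinal.cardinalCoeffD_sign hlam d⟩
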